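/- **Theorem (Carathéodory lower bound).** For $x\in\mathbb R^n$ let $|\mathrm{supp}(x)|$ be the number of nonzero coordinates of $x$, let $\Delta_n=\{x\in\mathbb R^n : x\ge 0,\ \sum_i x_i=1\}$, and let $\vec 1\in\mathbb R^n$ be the all-ones vector. For every $\varepsilon_0<1/2$ (for instance $\varepsilon_0=1/4$) there is a constant $K>0$, depending only on $\varepsilon_0$, such that for every real $p\ge 2$ and every $0<\varepsilon\le\varepsilon_0$ the following hold. 1. There is $n_0=n_0(p,\varepsilon)$ such that for every $n\ge n_0$ there is an $n\times n$ matrix $V=n^{-1/p}A$ with $A\in\{-1,1\}^{n\times n}$ such that (a) every column of $V$ has $\ell_p$ norm $1$; (b) $\|V\vec 1/n\|_p\le\varepsilon$; (c) every $x\in\Delta_n$ with $|\mathrm{supp}(x)|\le Kp/\varepsilon^2$ satisfies $\|Vx\|_p\ge 2\varepsilon$; (d) every $x\in\Delta_n$ with $|\mathrm{supp}(x)|\le Kp/\varepsilon^2$ satisfies $\|Vx-u\|_p\ge 2\varepsilon$, where $u=V\vec 1/n$. 2. If the entries of $A$ are independent and uniform on $\{-1,1\}$, then the probability that $V=n^{-1/p}A$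 satisfies (a)–(d) tends to $1$ as $n\to\infty$. 3. Consequently no dimension-free sparsity bound better than order $p/\varepsilon^2$ is possible: if $N\in\mathbb N$ is such that for all $d,m$, every $d\times m$ real matrix $V$ with columns in the unit $\ell_p$ ball and every $x\in\Delta_m$, there is $x'\in\Delta_m$ with $|\mathrm{supp}(x')|\le N$ and $\|Vx'-Vx\|_p\le\varepsilon$, then $N>Kp/\varepsilon^2$. -/

import Mathlib

open Filter Topology
open scoped Matrix

namespace ApproxCaratheodory

noncomputable section

/-- The `ℓ_p` norm of a real vector, for a real exponent `p` (used for `p ≥ 2`). -/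
def ellNorm {ι : Type*} [Fintype ι] (p : ℝ) (v : ι → ℝ) : ℝ :=
  ‖WithLp.toLp (ENNReal.ofReal p) v‖

/-- For `p > 0` this is the familiar formula. -/
theorem ellNorm_eq {ι : Type*} [Fintype ι] {p : ℝ} (hp : 0 < p) (v : ι → ℝ) :
    ellNorm p v = (∑ i, |v i| ^ p) ^ (1 / p) := by
  have h : (ENNReal.ofReal p).toReal = p := ENNReal.toReal_ofReal hp.le
  unfold ellNorm
  rw [PiLp.norm_eq_sum (by rw [h]; exact hp), h]
  simp [Real.norm_eq_abs]

/-- The uniform weights `𝟙 / n`. -/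
def uniformWeights (n : ℕ) : Fin n → ℝ := fun _ => 1 / (n : ℝ)

/-- The number of nonzero coordinates of `x`. -/
def sparsity {n : ℕ} (x : Fin n → ℝ) : ℕ := (Function.support x).ncard

/-- `V` is a lower bound instance for the exponent `p`, the accuracy `ε` and the sparsity
threshold `k`: its columns have unit `ℓ_p` norm, the uniform convex combination of the columns
is `ε`-close to `0`, and every convex combination of at most `k` columns is at distance at
least `2ε` from `0`, and also at distance at least `2ε` from the uniform combination. -/
structure IsHardInstance {n : ℕ} (p ε k : ℝ) (V : Matrix (Fin n) (Fin n) ℝ) : Prop where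
  norm_col : ∀ j, ellNorm p (fun i => V i j) = 1
  uniform_near : ellNorm p (V *ᵥ uniformWeights n) ≤ ε
  sparse_far : ∀ x ∈ stdSimplex ℝ (Fin n), (sparsity x : ℝ) ≤ k → 2 * ε ≤ ellNorm p (V *ᵥ x)
  sparse_far_uniform : ∀ x ∈ stdSimplex ℝ (Fin n), (sparsity x : ℝ) ≤ k →
    2 * ε ≤ ellNorm p (V *ᵥ x - V *ᵥ uniformWeights n)

/-- The scaled sign matrix `n^(-1/p) • A`, where `A` is an `n × n` matrix of signs
(`ℤˣ = {1, -1}`). -/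
def scaledSignMatrix {n : ℕ} (p : ℝ) (A : Matrix (Fin n) (Fin n) ℤˣ) :
    Matrix (Fin n) (Fin n) ℝ :=
  (n : ℝ) ^ (-(1 / p)) • A.map (fun s : ℤˣ => ((s : ℤ) : ℝ))

/-- The probability of the event `P` for an `n × n` matrix with independent uniform `±1` entries,
that is, for a uniformly random sign matrix. -/
def signMatrixProb (n : ℕ) (P : Matrix (Fin n) (Fin n) ℤˣ → Prop) : ℝ :=
  (Nat.card {A : Matrix (Fin n) (Fin n) ℤˣ // P A} : ℝ) /
    (Nat.card (Matrix (Fin n) (Fin n) ℤˣ) : ℝ)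

/-- `N` is a dimension-free sparsity bound for `ε`-approximation in `ℓ_p`: whatever the dimension
`d` and the number `m` of points, every convex combination of the columns of a matrix with columns
in the unit `ℓ_p` ball is within `ε` of a convex combination of at most `N` of the columns. -/
def IsSparsityBound (p ε : ℝ) (N : ℕ) : Prop :=
  ∀ (d m : ℕ) (V : Matrix (Fin d) (Fin m) ℝ), (∀ j, ellNorm p (fun i => V i j) ≤ 1) →
    ∀ x ∈ stdSimplex ℝ (Fin m), ∃ x' ∈ stdSimplex ℝ (Fin m),
      sparsity x' ≤ N ∧ ellNorm p (V *ᵥ x' - V *ᵥ x) ≤ ε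

end

end ApproxCaratheodory

/-! For `x` supported on a set `T` of `k` columns, `‖Vx‖_p^p` is the average over rows of `|∑ x_j
A_ij|^p`. With `k` fixed and `n` large, a Chernoff and union bound gives every sign pattern on every
such `T` in almost `n / 2^k` rows. This average is then at least `1 - δ` times a Rademacher moment,
for all `x` at once and without a net (`PatternRich.le_ellNorm`).

It remains to bound that moment below (`exists_moment_bound`). Cut the support into `m ≈ p` blocks
of size `q ≈ K/ε²`. Flipping whole blocks makes all block sums nonnegative at a cost of `2^m`, only
a constant after the `p`-th root. Khintchine and Cauchy–Schwarz make the absolute block sums total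
at least `1/(2√q)` on average, which beats `2ε` for small `K`.

The uniform combination is tiny: row means have absolute value at most `1` and their squares sum to
`1` in expectation, so Markov applies. Hence (d) follows from (c) with a little slack. -/

namespace ApproxCaratheodory

open Finset
open scoped BigOperators

/-! ### Lower bounds for moments of Rademacher sums. -/

section Rademacher

variable {ι : Type*} [Fintype ι] [DecidableEq ι]

theorem sign_sq (u : ℤˣ) : ((u : ℤ) : ℝ) ^ 2 = 1 := by
  rcases Int.units_eq_one_or u with h | h <;> simp [h]

theorem abs_sign (u : ℤˣ) : |((u : ℤ) : ℝ)| = 1 := by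
  rcases Int.units_eq_one_or u with h | h <;> simp [h]

/-- The expectation of a function of uniform signs is invariant under sign changes. -/
theorem expect_sign_mul (τ : ι → ℤˣ) (f : (ι → ℤˣ) → ℝ) :
    𝔼 σ, f (τ * σ) = 𝔼 σ, f σ :=
  Fintype.expect_equiv (Equiv.mulLeft τ) _ _ (fun _ => rfl)

/-- The Rademacher sum over the index set `s`. -/
noncomputable def signSum (x : ι → ℝ) (s : Finset ι) (σ : ι → ℤˣ) : ℝ :=
  ∑ j ∈ s, x j * ((σ j : ℤ) : ℝ)

/-- Flipping the sign at `a` preserves the measure; averaging over the flip cancels odd powers in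
the inductions for moments 2 and 4. -/
theorem expect_signSum_insert (x : ι → ℝ) {s : Finset ι} {a : ι} (ha : a ∉ s) (f : ℝ → ℝ) :
    𝔼 σ, f (signSum x (insert a s) σ) =
      𝔼 σ : ι → ℤˣ, (f (signSum x s σ + x a * ((σ a : ℤ) : ℝ)) +
        f (signSum x s σ - x a * ((σ a : ℤ) : ℝ))) / 2 := by
  have h1 : ∀ σ : ι → ℤˣ, signSum x (insert a s) σ = signSum x s σ + x a * ((σ a : ℤ) : ℝ) := by
    intro σ; unfold signSum; rw [sum_insert ha, add_comm]
  have h2 : ∀ σ : ι → ℤˣ, signSum x (insert a s) (Pi.mulSingle a (-1) * σ) =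
      signSum x s σ - x a * ((σ a : ℤ) : ℝ) := by
    intro σ
    rw [h1]
    have : signSum x s (Pi.mulSingle a (-1) * σ) = signSum x s σ := by
      unfold signSum
      refine sum_congr rfl fun j hj => ?_
      have : j ≠ a := fun h => ha (h ▸ hj)
      simp [Pi.mulSingle_eq_of_ne this]
    rw [this]; simp [sub_eq_add_neg]
  have h3 := expect_sign_mul (Pi.mulSingle a (-1)) (fun σ => f (signSum x (insert a s) σ))
  simp only [h2] at h3
  simp only [h1] at h3 ⊢
  rw [← expect_div, expect_add_distrib, h3]
  ring

theorem expect_signSum_sq (x : ι → ℝ) (s : Finset ι) :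
    𝔼 σ, signSum x s σ ^ 2 = ∑ j ∈ s, x j ^ 2 := by
  induction s using Finset.induction_on with
  | empty => simp [signSum]
  | insert a s ha ih =>
    rw [expect_signSum_insert x ha (fun y => y ^ 2), sum_insert ha, ← ih]
    have : ∀ σ : ι → ℤˣ, ((signSum x s σ + x a * ((σ a : ℤ) : ℝ)) ^ 2 +
        (signSum x s σ - x a * ((σ a : ℤ) : ℝ)) ^ 2) / 2 = x a ^ 2 + signSum x s σ ^ 2 := by
      intro σ; linear_combination x a ^ 2 * sign_sq (σ a)
    simp only [this]
    rw [expect_add_distrib, expect_const univ_nonempty]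

theorem expect_signSum_pow_four (x : ι → ℝ) (s : Finset ι) :
    𝔼 σ, signSum x s σ ^ 4 ≤ 3 * (∑ j ∈ s, x j ^ 2) ^ 2 := by
  induction s using Finset.induction_on with
  | empty => simp [signSum]
  | insert a s ha ih =>
    rw [expect_signSum_insert x ha (fun y => y ^ 4), sum_insert ha]
    have : ∀ σ : ι → ℤˣ, ((signSum x s σ + x a * ((σ a : ℤ) : ℝ)) ^ 4 +
        (signSum x s σ - x a * ((σ a : ℤ) : ℝ)) ^ 4) / 2 =
        x a ^ 4 + (6 * x a ^ 2) * signSum x s σ ^ 2 + signSum x s σ ^ 4 := by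
      intro σ
      linear_combination (6 * x a ^ 2 * signSum x s σ ^ 2 +
        x a ^ 4 * (((σ a : ℤ) : ℝ) ^ 2 + 1)) * sign_sq (σ a)
    simp only [this]
    rw [expect_add_distrib, expect_add_distrib, expect_const univ_nonempty, ← mul_expect,
      expect_signSum_sq]
    nlinarith [sq_nonneg (x a ^ 2)]

/-- A form of Khintchine's inequality. -/
theorem le_expect_abs_signSum (x : ι → ℝ) (s : Finset ι) :
    √(∑ j ∈ s, x j ^ 2) / 2 ≤ 𝔼 σ, |signSum x s σ| := by
  set a := √(∑ j ∈ s, x j ^ 2) with ha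
  have hs0 : 0 ≤ ∑ j ∈ s, x j ^ 2 := sum_nonneg fun _ _ => sq_nonneg _
  have ha2 : ∑ j ∈ s, x j ^ 2 = a ^ 2 := (Real.sq_sqrt hs0).symm
  rcases (Real.sqrt_nonneg _ : 0 ≤ a).eq_or_lt with h0 | h0
  · refine le_trans (by linarith : a / 2 ≤ 0) ?_
    exact expect_nonneg fun _ _ => abs_nonneg _
  have key : ∀ y : ℝ, 0.9 * a ^ 2 * y ^ 2 - 0.108 * y ^ 4 ≤ a ^ 3 * |y| := by
    intro y
    have h1 : y ^ 2 = |y| ^ 2 := (sq_abs y).symm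
    have h2 : y ^ 4 = |y| ^ 4 := by rw [show 4 = 2 * 2 from rfl, pow_mul, pow_mul, h1]
    rw [h1, h2]
    have hz := abs_nonneg y
    generalize |y| = z at hz
    have : 0 ≤ z * ((z - 5 / 3 * a) ^ 2 * (z + 10 / 3 * a)) := by positivity
    nlinarith
  have hE : 𝔼 σ, (0.9 * a ^ 2 * signSum x s σ ^ 2 - 0.108 * signSum x s σ ^ 4) ≤
      𝔼 σ, a ^ 3 * |signSum x s σ| := expect_le_expect fun σ _ => key _
  rw [expect_sub_distrib, ← mul_expect, ← mul_expect, ← mul_expect, expect_signSum_sq, ha2] at hE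
  have h4 := expect_signSum_pow_four x s
  rw [ha2] at h4
  have : a ^ 3 * (a / 2) ≤ a ^ 3 * 𝔼 σ, |signSum x s σ| := by nlinarith [pow_pos h0 4]
  exact le_of_mul_le_mul_left this (by positivity)

theorem rpow_expect_le {α : Type*} [Fintype α] [Nonempty α] {p : ℝ} (hp : 1 ≤ p) (f : α → ℝ)
    (hf : ∀ a, 0 ≤ f a) : (𝔼 a, f a) ^ p ≤ 𝔼 a, f a ^ p := by
  have hc : (0 : ℝ) < Fintype.card α := by exact_mod_cast Fintype.card_pos
  have := Real.rpow_arith_mean_le_arith_mean_rpow univ (fun _ : α => (Fintype.card α : ℝ)⁻¹) f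
    (fun _ _ => by positivity) (by simp [hc.ne']) (fun a _ => hf a) hp
  simpa only [Fintype.expect_eq_sum_div_card, ← mul_sum, inv_mul_eq_div, ← sum_div] using this

/-- Grouping a Rademacher sum into blocks and making all the block sums positive. -/
theorem expect_abs_signSum_rpow_ge {β : Type*} [Fintype β] [DecidableEq β] {p : ℝ} (hp : 1 ≤ p)
    (x : ι → ℝ) (b : ι → β) :
    (∑ c, 𝔼 σ, |signSum x {j | b j = c} σ|) ^ p ≤
      2 ^ Fintype.card β * 𝔼 σ, |signSum x univ σ| ^ p := by
  have hsplit : ∀ (τ : β → ℤˣ) (σ : ι → ℤˣ), signSum x univ ((fun j => τ (b j)) * σ) =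
      ∑ c, ((τ c : ℤ) : ℝ) * signSum x {j | b j = c} σ := by
    intro τ σ
    unfold signSum
    rw [← sum_fiberwise univ b]
    refine sum_congr rfl fun c _ => ?_
    rw [mul_sum]
    refine sum_congr rfl fun j hj => ?_
    rw [mem_filter] at hj
    simp only [Pi.mul_apply, Units.val_mul, Int.cast_mul, hj.2]
    ring
  have hpt : ∀ σ : ι → ℤˣ, (∑ c, |signSum x {j | b j = c} σ|) ^ p ≤
      ∑ τ : β → ℤˣ, |signSum x univ ((fun j => τ (b j)) * σ)| ^ p := by
    intro σ
    -- The good `τ` depends on `σ`; summing over all `τ` removes this dependence and costs the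
    -- factor `2 ^ card β`.
    let τ : β → ℤˣ := fun c => if 0 ≤ signSum x {j | b j = c} σ then 1 else -1
    have hτ : signSum x univ ((fun j => τ (b j)) * σ) = ∑ c, |signSum x {j | b j = c} σ| := by
      rw [hsplit]
      refine sum_congr rfl fun c _ => ?_
      by_cases h : 0 ≤ signSum x {j | b j = c} σ
      · simp [τ, h, abs_of_nonneg h]
      · simp [τ, h, abs_of_neg (not_le.1 h)]
    refine le_trans ?_ (single_le_sum (f := fun τ : β → ℤˣ =>
      |signSum x univ ((fun j => τ (b j)) * σ)| ^ p) (fun τ _ => by positivity) (mem_univ τ))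
    rw [hτ, abs_of_nonneg (sum_nonneg fun _ _ => abs_nonneg _)]
  calc (∑ c, 𝔼 σ, |signSum x {j | b j = c} σ|) ^ p
      = (𝔼 σ, ∑ c, |signSum x {j | b j = c} σ|) ^ p := by rw [expect_sum_comm]
    _ ≤ 𝔼 σ, (∑ c, |signSum x {j | b j = c} σ|) ^ p :=
        rpow_expect_le hp _ fun σ => sum_nonneg fun _ _ => abs_nonneg _
    _ ≤ 𝔼 σ, ∑ τ : β → ℤˣ, |signSum x univ ((fun j => τ (b j)) * σ)| ^ p :=
        expect_le_expect fun σ _ => hpt σ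
    _ = ∑ τ : β → ℤˣ, 𝔼 σ, |signSum x univ ((fun j => τ (b j)) * σ)| ^ p := expect_sum_comm ..
    _ = ∑ τ : β → ℤˣ, 𝔼 σ, |signSum x univ σ| ^ p :=
        sum_congr rfl fun τ _ => expect_sign_mul _ fun σ => |signSum x univ σ| ^ p
    _ = _ := by simp

/-- Blocks of size one lose no Khintchine constant, which is what lets `ε₀` approach `1/2`. -/
theorem expect_abs_signSum_rpow_ge_singletons {p : ℝ} (hp : 1 ≤ p) {x : ι → ℝ}
    (hx0 : ∀ j, 0 ≤ x j) (hx1 : ∑ j, x j = 1) :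
    1 ≤ 2 ^ Fintype.card ι * 𝔼 σ, |signSum x univ σ| ^ p := by
  have h := expect_abs_signSum_rpow_ge hp x id
  have h1 : ∀ c, 𝔼 σ, |signSum x {j | id j = c} σ| = x c := by
    intro c
    have : ∀ σ : ι → ℤˣ, |signSum x {j | id j = c} σ| = x c := by
      intro σ
      simp [signSum, filter_eq', abs_mul, abs_sign, abs_of_nonneg (hx0 c)]
    simp only [this]
    exact expect_const univ_nonempty _
  simpa only [h1, hx1, Real.one_rpow] using h

theorem expect_abs_signSum_rpow_ge_blocks {p : ℝ} (hp : 1 ≤ p) {x : ι → ℝ}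
    (hx1 : ∑ j, x j = 1) {m q : ℕ} (hq : 0 < q)
    (hmq : Fintype.card ι ≤ m * q) :
    (1 / (2 * √q)) ^ p ≤ 2 ^ m * 𝔼 σ, |signSum x univ σ| ^ p := by
  obtain ⟨e⟩ : Nonempty (ι ↪ Fin m × Fin q) :=
    Function.Embedding.nonempty_of_card_le (by simpa using hmq)
  have h := expect_abs_signSum_rpow_ge hp x (fun j => (e j).1)
  rw [Fintype.card_fin] at h
  refine le_trans (Real.rpow_le_rpow (by positivity) ?_ (by linarith)) h
  have hq' : (0 : ℝ) < √q := Real.sqrt_pos.2 (by exact_mod_cast hq)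
  calc 1 / (2 * √q) = ∑ c, (∑ j with (e j).1 = c, x j) / (2 * √q) := by
        rw [← sum_div, sum_fiberwise, hx1]
    _ ≤ _ := by
      refine sum_le_sum fun c _ => le_trans ?_ (le_expect_abs_signSum x _)
      have hcard : #{j | (e j).1 = c} ≤ q := by
        have := card_le_card_of_injOn (s := {j | (e j).1 = c}) (t := (univ : Finset (Fin q)))
          (fun j => (e j).2) (fun _ _ => by simp) (by
            intro i hi j hj hij
            simp only [coe_filter, mem_univ, true_and, Set.mem_ofPred_eq] at hi hj
            exact e.injective (Prod.ext (hi.trans hj.symm) hij))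
        simpa using this
      have h2 : (∑ j with (e j).1 = c, x j) ≤ √q * √(∑ j with (e j).1 = c, x j ^ 2) := by
        rw [← Real.sqrt_mul (by positivity)]
        refine Real.le_sqrt_of_sq_le (sq_sum_le_card_mul_sum_sq.trans ?_)
        gcongr
      rw [div_le_div_iff₀ (by positivity) (by norm_num)]
      nlinarith

/-- The moment bound behind the theorem: a Rademacher sum with few convex weights has
`p`-th moment norm larger than `2ε`. -/
theorem exists_moment_bound {ε₀ : ℝ} (hε₀ : ε₀ < 1 / 2) :
    ∃ K : ℝ, 0 < K ∧ ∀ p : ℝ, 2 ≤ p → ∀ ε : ℝ, 0 < ε → ε ≤ ε₀ → ∃ L : ℝ, 2 * ε < L ∧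
      ∀ (ι : Type) [Fintype ι] [DecidableEq ι], (Fintype.card ι : ℝ) ≤ K * p / ε ^ 2 →
        ∀ x : ι → ℝ, (∀ j, 0 ≤ x j) → ∑ j, x j = 1 → L ^ p ≤ 𝔼 σ, |signSum x univ σ| ^ p := by
  -- `K ≤ 1/400` serves small `ε`, via `q ε² ≤ K + ε² ≤ 1/200`. The last condition serves `ε ≥
  -- 1/20`, where `k/p ≤ K/ε² ≤ 400 K`.
  obtain ⟨K, hK0, hK1, hK2⟩ : ∃ K : ℝ, 0 < K ∧ K ≤ 1 / 400 ∧
      2 * ε₀ < (2 : ℝ) ^ (-(400 * K)) := by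
    have hc : Tendsto (fun K : ℝ => (2 : ℝ) ^ (-(400 * K))) (𝓝[>] 0) (𝓝 1) := by
      have : Continuous fun K : ℝ => (2 : ℝ) ^ (-(400 * K)) :=
        Real.continuous_const_rpow (by norm_num) |>.comp (by fun_prop)
      simpa using (this.tendsto 0).mono_left nhdsWithin_le_nhds
    have h1 := hc.eventually (lt_mem_nhds (show 2 * ε₀ < 1 by linarith))
    have h2 : ∀ᶠ K : ℝ in 𝓝[>] 0, K < 1 / 400 :=
      nhdsWithin_le_nhds (gt_mem_nhds (by norm_num))
    obtain ⟨K, ⟨h3, h4⟩, h5⟩ := ((h1.and h2).and self_mem_nhdsWithin).exists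
    exact ⟨K, h5, h4.le, h3⟩
  refine ⟨K, hK0, fun p hp ε hε hεε₀ => ?_⟩
  have hp0 : 0 < p := by linarith
  have hpow : ∀ k : ℕ, ((2 : ℝ) ^ (-(k / p))) ^ p * 2 ^ k = 1 := by
    intro k
    rw [← Real.rpow_mul (by norm_num), ← Real.rpow_natCast 2 k, ← Real.rpow_add (by norm_num)]
    rw [show -(k / p) * p + (k : ℝ) = 0 by field_simp; ring, Real.rpow_zero]
  rcases le_or_gt (1 / 20) ε with h20 | h20
  · refine ⟨2 ^ (-(400 * K)), by linarith, fun ι _ _ hcard x hx0 hx1 => ?_⟩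
    set k := Fintype.card ι with hk
    have h1 := expect_abs_signSum_rpow_ge_singletons (by linarith : 1 ≤ p) hx0 hx1
    have h2 : (2 : ℝ) ^ (-(400 * K)) ≤ 2 ^ (-(k / p)) := by
      refine Real.rpow_le_rpow_of_exponent_le (by norm_num) (neg_le_neg ?_)
      rw [div_le_iff₀ hp0]
      refine hcard.trans ?_
      rw [div_le_iff₀ (by positivity)]
      have : 1 / 400 ≤ ε ^ 2 := by nlinarith
      have : 0 < K * p := by positivity
      nlinarith
    refine (Real.rpow_le_rpow (by positivity) h2 hp0.le).trans ?_
    have h3 := hpow k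
    rw [← h3, mul_comm] at h1
    exact le_of_mul_le_mul_left h1 (by positivity)
  · set m := ⌈p⌉₊
    set q := ⌊K / ε ^ 2⌋₊ + 1 with hqdef
    have hpm : p ≤ m := Nat.le_ceil p
    have hmp : (m : ℝ) ≤ 3 / 2 * p := by
      have := Nat.ceil_lt_add_one hp0.le
      linarith
    have hKq : K / ε ^ 2 ≤ q := by
      rw [hqdef]; push_cast; exact (Nat.lt_floor_add_one _).le
    have hq0 : 0 < q := Nat.succ_pos _
    have hqε : q * ε ^ 2 ≤ 1 / 200 := by
      have h1 : (q : ℝ) ≤ K / ε ^ 2 + 1 := by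
        rw [hqdef]; push_cast
        linarith [Nat.floor_le (show 0 ≤ K / ε ^ 2 by positivity)]
      have h2 : K / ε ^ 2 * ε ^ 2 = K := by field_simp
      nlinarith [mul_le_mul_of_nonneg_right h1 (sq_nonneg ε)]
    -- The target: with `2^(-m/p) ≥ 1/3`, the bound `1/(6√q)` exceeds `2ε` exactly when `√q ε <
    -- 1/12`.
    have hsq : √q * ε < 1 / 12 := by
      have h1 : (√q * ε) ^ 2 = q * ε ^ 2 := by rw [mul_pow, Real.sq_sqrt (by positivity)]
      exact lt_of_pow_lt_pow_left₀ 2 (by norm_num) (by rw [h1]; norm_num; linarith)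
    have hsq0 : 0 < √(q : ℝ) := Real.sqrt_pos.2 (by exact_mod_cast hq0)
    have h13 : (1 : ℝ) / 3 ≤ 2 ^ (-(m / p)) := by
      have h1 : (2 : ℝ) ^ (-(3 / 2) : ℝ) ≤ 2 ^ (-(m / p)) := by
        refine Real.rpow_le_rpow_of_exponent_le (by norm_num) (neg_le_neg ?_)
        rwa [div_le_iff₀ hp0]
      refine le_trans ?_ h1
      have h2 : ((2 : ℝ) ^ (-(3 / 2) : ℝ)) ^ 2 = 1 / 8 := by
        rw [← Real.rpow_natCast, ← Real.rpow_mul (by norm_num)]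
        norm_num [Real.rpow_neg]
      exact le_of_sq_le_sq (by rw [h2]; norm_num) (by positivity)
    refine ⟨2 ^ (-(m / p)) * (1 / (2 * √q)), ?_, fun ι _ _ hcard x hx0 hx1 => ?_⟩
    · refine lt_of_lt_of_le ?_ (mul_le_mul_of_nonneg_right h13 (by positivity))
      rw [div_mul_div_comm, lt_div_iff₀ (by positivity)]
      nlinarith
    · have hmq : Fintype.card ι ≤ m * q := by
        have : (Fintype.card ι : ℝ) ≤ m * q := by
          refine hcard.trans ?_
          rw [mul_comm K p, mul_div_assoc]
          exact mul_le_mul hpm hKq (by positivity) (by positivity)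
        exact_mod_cast this
      have h1 := expect_abs_signSum_rpow_ge_blocks (by linarith : 1 ≤ p) hx1 hq0 hmq
      rw [Real.mul_rpow (by positivity) (by positivity)]
      refine (mul_le_mul_of_nonneg_left h1 (by positivity)).trans_eq ?_
      rw [← mul_assoc, hpow, one_mul]

end Rademacher

/-! ### Sign patterns in the rows of a random matrix. -/

section Concentration

theorem expect_prod_eq_pow {α : Type*} [Fintype α] (n : ℕ) (f : α → ℝ) :
    𝔼 A : Fin n → α, ∏ i, f (A i) = (𝔼 a, f a) ^ n := by
  simp only [Fintype.expect_eq_sum_div_card]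
  rw [← Fintype.sum_pow, div_pow]
  simp

/-- A lower-tail Chernoff bound. -/
theorem expect_count_lt_le {α : Type*} [Fintype α] [Nonempty α] (Q : α → Prop) [DecidablePred Q]
    {q δ : ℝ} (hδ : 0 ≤ δ) (hq : 𝔼 a, (if Q a then (1 : ℝ) else 0) = q) (n : ℕ) :
    𝔼 A : Fin n → α, (if (#{i | Q (A i)} : ℝ) < (1 - δ) * q * n then (1 : ℝ) else 0) ≤
      Real.exp (-(q * (1 - Real.exp (-δ) - δ + δ ^ 2))) ^ n := by
  have hrow : 𝔼 a, Real.exp (-δ * if Q a then (1 : ℝ) else 0) = 1 - q * (1 - Real.exp (-δ)) := by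
    have : ∀ a, Real.exp (-δ * if Q a then (1 : ℝ) else 0) =
        1 - (if Q a then (1 : ℝ) else 0) * (1 - Real.exp (-δ)) := by
      intro a; split_ifs <;> simp
    simp only [this]
    rw [expect_sub_distrib, ← expect_mul, hq, expect_const univ_nonempty]
  have hrow0 : 0 ≤ 1 - q * (1 - Real.exp (-δ)) := by
    rw [← hrow]; exact expect_nonneg fun _ _ => (Real.exp_pos _).le
  have hpt : ∀ A : Fin n → α, (if (#{i | Q (A i)} : ℝ) < (1 - δ) * q * n then (1 : ℝ) else 0) ≤
      Real.exp (δ * (1 - δ) * q) ^ n * ∏ i, Real.exp (-δ * if Q (A i) then (1 : ℝ) else 0) := by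
    intro A
    split_ifs with h
    · rw [← Real.exp_sum, ← mul_sum, ← Real.exp_nat_mul, ← Real.exp_add, sum_boole]
      refine Real.one_le_exp ?_
      nlinarith
    · positivity
  refine (expect_le_expect fun A _ => hpt A).trans ?_
  rw [← mul_expect, expect_prod_eq_pow n (fun a => Real.exp (-δ * if Q a then (1 : ℝ) else 0)),
    hrow, ← mul_pow]
  refine pow_le_pow_left₀ (by positivity) ?_ n
  have h1 : 1 - q * (1 - Real.exp (-δ)) ≤ Real.exp (-(q * (1 - Real.exp (-δ)))) := by
    linarith [Real.add_one_le_exp (-(q * (1 - Real.exp (-δ))))]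
  refine (mul_le_mul_of_nonneg_left h1 (Real.exp_pos _).le).trans_eq ?_
  rw [← Real.exp_add]; congr 1; ring

/-- Since `exp (-δ) ≤ 1/(1 + δ)`, the exponent is at least `δ³/(1 + δ)`. -/
theorem chernoff_exponent_pos {δ : ℝ} (hδ : 0 < δ) : 0 < 1 - Real.exp (-δ) - δ + δ ^ 2 := by
  have h1 : δ + 1 ≤ Real.exp δ := Real.add_one_le_exp δ
  have h2 : Real.exp (-δ) * Real.exp δ = 1 := by rw [← Real.exp_add]; simp
  have h3 : Real.exp (-δ) * (δ + 1) ≤ 1 :=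
    (mul_le_mul_of_nonneg_left h1 (Real.exp_pos _).le).trans_eq h2
  have h4 : 0 < δ ^ 3 := by positivity
  by_contra! h
  nlinarith

/-- A uniformly random sign vector restricts to a given pattern on `T` with probability
`2 ^ (-#T)`. -/
theorem expect_restrict_eq {ι : Type*} [Fintype ι] [DecidableEq ι] (T : Finset ι) (π : T → ℤˣ) :
    𝔼 r : ι → ℤˣ, (if (fun j : T => r j) = π then (1 : ℝ) else 0) = 1 / 2 ^ #T := by
  have hinv : ∀ π : T → ℤˣ, 𝔼 r : ι → ℤˣ, (if (fun j : T => r j) = π then (1 : ℝ) else 0) =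
      𝔼 r : ι → ℤˣ, (if (fun j : T => r j) = 1 then (1 : ℝ) else 0) := by
    intro π
    -- Multiplying by `π`, extended by `1` off `T`, exchanges the pattern `π` with the pattern `1`.
    rw [← expect_sign_mul (fun j => if h : j ∈ T then π ⟨j, h⟩ else 1)]
    refine expect_congr rfl fun r _ => ?_
    congr 1
    simp [funext_iff]
  have hsum : ∑ π : T → ℤˣ, 𝔼 r : ι → ℤˣ, (if (fun j : T => r j) = π then (1 : ℝ) else 0) = 1 := by
    rw [← expect_sum_comm]
    simp
  rw [sum_congr rfl fun π _ => hinv π] at hsum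
  rw [hinv π]
  simp only [sum_const, card_univ, Fintype.card_fun, Fintype.card_units_int, Fintype.card_coe,
    nsmul_eq_mul, Nat.cast_pow, Nat.cast_ofNat] at hsum
  rw [eq_div_iff (by positivity), mul_comm, hsum]

variable {n : ℕ}

/-- Every sign pattern on every `k`-set of columns appears in almost the expected number of
rows. -/
def PatternRich (δ : ℝ) (k : ℕ) (A : Matrix (Fin n) (Fin n) ℤˣ) : Prop :=
  ∀ T ∈ powersetCard k (univ : Finset (Fin n)), ∀ π : T → ℤˣ,
    (1 - δ) * (1 / 2 ^ k) * n ≤ (#{i | (fun j : T => A i j) = π} : ℝ)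

/-- Grouping rows by their pattern on `T` handles every nonnegative `F` at once, hence every weight
vector on `T`. -/
theorem PatternRich.le_sum {δ : ℝ} {k : ℕ} {A : Matrix (Fin n) (Fin n) ℤˣ}
    (hA : PatternRich δ k A) {T : Finset (Fin n)} (hT : #T = k) (F : (T → ℤˣ) → ℝ)
    (hF : ∀ π, 0 ≤ F π) :
    (1 - δ) * n * 𝔼 π, F π ≤ ∑ i, F (fun j : T => A i j) := by
  rw [← sum_fiberwise univ (fun i => (fun j : T => A i j)), Fintype.expect_eq_sum_div_card,
    sum_div, mul_sum]
  refine sum_le_sum fun π _ => ?_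
  have h1 : ∑ i with (fun j : T => A i j) = π, F (fun j : T => A i j) =
      #{i | (fun j : T => A i j) = π} * F π := by
    rw [sum_congr rfl (g := fun _ => F π) (fun i hi => by rw [(mem_filter.1 hi).2])]
    simp
  rw [h1]
  refine le_trans (le_of_eq ?_) (mul_le_mul_of_nonneg_right
    (hA T (mem_powersetCard.2 ⟨subset_univ _, hT⟩) π) (hF π))
  simp [hT]; ring

theorem expect_sum_row_sq (hn : n ≠ 0) :
    𝔼 A : Matrix (Fin n) (Fin n) ℤˣ, ∑ i, (∑ j, ((A i j : ℤ) : ℝ) / n) ^ 2 = 1 := by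
  rw [expect_sum_comm]
  have h : ∀ i : Fin n, 𝔼 A : Matrix (Fin n) (Fin n) ℤˣ, (∑ j, ((A i j : ℤ) : ℝ) / n) ^ 2 =
      1 / n := by
    intro i
    have h1 := expect_signSum_sq (fun _ : Fin n × Fin n => 1 / (n : ℝ)) ({i} ×ˢ univ)
    rw [Fintype.expect_equiv (Equiv.curry (Fin n) (Fin n) ℤˣ) _
      (fun A => (∑ j, ((A i j : ℤ) : ℝ) / n) ^ 2)] at h1
    · refine h1.trans ?_
      have : (n : ℝ) ≠ 0 := by exact_mod_cast hn
      simp; field_simp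
    · intro σ
      unfold signSum
      rw [sum_product]
      simp [div_eq_inv_mul]
  simp only [h]
  have : (n : ℝ) ≠ 0 := by exact_mod_cast hn
  simp [this]

open Classical in
theorem signMatrixProb_eq_expect (P : Matrix (Fin n) (Fin n) ℤˣ → Prop) :
    signMatrixProb n P = 𝔼 A, if P A then (1 : ℝ) else 0 := by
  rw [Fintype.expect_eq_sum_div_card, signMatrixProb, sum_boole, Nat.card_eq_fintype_card,
    Nat.card_eq_fintype_card, Fintype.card_subtype]

theorem signMatrixProb_le_one (P : Matrix (Fin n) (Fin n) ℤˣ → Prop) :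
    signMatrixProb n P ≤ 1 := by
  classical
  rw [signMatrixProb_eq_expect]
  exact expect_le univ_nonempty fun A _ => by split_ifs <;> norm_num

/-- Union bound for the two events that make a sign matrix a hard instance. -/
theorem le_signMatrixProb_of_patternRich (hn : n ≠ 0) {δ η : ℝ} (hδ : 0 ≤ δ) (hη : 0 < η)
    (k : ℕ) (P : Matrix (Fin n) (Fin n) ℤˣ → Prop)
    (hP : ∀ A, PatternRich δ k A → ∑ i, (∑ j, ((A i j : ℤ) : ℝ) / n) ^ 2 ≤ η * n → P A) :
    1 - n ^ k * 2 ^ k * Real.exp (-(1 / 2 ^ k * (1 - Real.exp (-δ) - δ + δ ^ 2))) ^ n -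
      1 / (η * n) ≤ signMatrixProb n P := by
  classical
  have hn0 : (0 : ℝ) < n := by exact_mod_cast Nat.pos_of_ne_zero hn
  set S := powersetCard k (univ : Finset (Fin n))
  let bad : (T : Finset (Fin n)) → (T → ℤˣ) → Matrix (Fin n) (Fin n) ℤˣ → ℝ := fun T π A =>
    if (#{i | (fun j : T => A i j) = π} : ℝ) < (1 - δ) * (1 / 2 ^ k) * n then 1 else 0
  have hbad0 : ∀ T π A, 0 ≤ bad T π A := fun T π A => by
    dsimp only [bad]; split_ifs <;> norm_num
  have hpt : ∀ A : Matrix (Fin n) (Fin n) ℤˣ, 1 - ∑ T ∈ S, ∑ π : T → ℤˣ, bad T π A -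
      (∑ i, (∑ j, ((A i j : ℤ) : ℝ) / n) ^ 2) / (η * n) ≤ if P A then (1 : ℝ) else 0 := by
    intro A
    have h1 : 0 ≤ ∑ T ∈ S, ∑ π : T → ℤˣ, bad T π A :=
      sum_nonneg fun T _ => sum_nonneg fun π _ => hbad0 T π A
    have h2 : 0 ≤ (∑ i, (∑ j, ((A i j : ℤ) : ℝ) / n) ^ 2) / (η * n) := by positivity
    split_ifs with h
    · linarith
    · by_cases hR : PatternRich δ k A
      · have h3 := mt (hP A hR) h
        have : 1 ≤ (∑ i, (∑ j, ((A i j : ℤ) : ℝ) / n) ^ 2) / (η * n) := by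
          rw [one_le_div (by positivity)]; exact (not_le.1 h3).le
        linarith
      · unfold PatternRich at hR
        push Not at hR
        obtain ⟨T, hT, π, hπ⟩ := hR
        have h3 : bad T π A = 1 := if_pos hπ
        have h4 : bad T π A ≤ ∑ π : T → ℤˣ, bad T π A :=
          single_le_sum (f := fun π => bad T π A) (fun π _ => hbad0 T π A) (mem_univ π)
        have h5 : ∑ π : T → ℤˣ, bad T π A ≤ ∑ T ∈ S, ∑ π : T → ℤˣ, bad T π A :=
          single_le_sum (f := fun T : Finset (Fin n) => ∑ π : T → ℤˣ, bad T π A)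
            (fun T _ => sum_nonneg fun π _ => hbad0 T π A) hT
        linarith
  rw [signMatrixProb_eq_expect]
  refine le_trans ?_ (expect_le_expect fun A _ => hpt A)
  rw [expect_sub_distrib, expect_sub_distrib, expect_const univ_nonempty, ← expect_div,
    expect_sum_row_sq hn, expect_sum_comm]
  refine sub_le_sub_right (sub_le_sub_left ?_ 1) _
  set ρ := Real.exp (-(1 / 2 ^ k * (1 - Real.exp (-δ) - δ + δ ^ 2)))
  calc ∑ T ∈ S, 𝔼 A, ∑ π : T → ℤˣ, bad T π A ≤ ∑ T ∈ S, 2 ^ k * ρ ^ n := by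
        refine sum_le_sum fun T hT => ?_
        have hTk : #T = k := (mem_powersetCard.1 hT).2
        rw [expect_sum_comm]
        refine (sum_le_card_nsmul _ _ (ρ ^ n) fun π _ => ?_).trans (by simp [hTk])
        have hq := expect_restrict_eq T π
        rw [hTk] at hq
        exact expect_count_lt_le (fun r : Fin n → ℤˣ => (fun j : T => r j) = π) hδ hq n
    _ = (n.choose k : ℝ) * (2 ^ k * ρ ^ n) := by simp [S]
    _ ≤ n ^ k * (2 ^ k * ρ ^ n) := by
        gcongr
        exact_mod_cast Nat.choose_le_pow n k
    _ = _ := by ring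

end Concentration

/-! ### From random sign matrices to hard instances. -/

section HardInstance

theorem ellNorm_nonneg {ι : Type*} [Fintype ι] {p : ℝ} (hp : 0 < p) (v : ι → ℝ) :
    0 ≤ ellNorm p v := by
  rw [ellNorm_eq hp]; positivity

theorem ellNorm_sub_ge {ι : Type*} [Fintype ι] {p : ℝ} (hp : 1 ≤ p) (v w : ι → ℝ) :
    ellNorm p v - ellNorm p w ≤ ellNorm p (v - w) := by
  have : Fact (1 ≤ ENNReal.ofReal p) := ⟨by simpa using ENNReal.ofReal_le_ofReal hp⟩
  exact norm_sub_norm_le (WithLp.toLp (ENNReal.ofReal p) v) (WithLp.toLp (ENNReal.ofReal p) w)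

variable {n : ℕ}

theorem ellNorm_smul_rpow (hn : n ≠ 0) {p : ℝ} (hp : 0 < p) (v : Fin n → ℝ) :
    ellNorm p ((n : ℝ) ^ (-(1 / p)) • v) ^ p = (∑ i, |v i| ^ p) / n := by
  have hn0 : (0 : ℝ) < n := by exact_mod_cast Nat.pos_of_ne_zero hn
  rw [ellNorm_eq hp, ← Real.rpow_mul (sum_nonneg fun _ _ => by positivity),
    one_div_mul_cancel hp.ne', Real.rpow_one, sum_div]
  refine sum_congr rfl fun i _ => ?_
  rw [Pi.smul_apply, smul_eq_mul, abs_mul, abs_of_pos (by positivity),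
    Real.mul_rpow (by positivity) (abs_nonneg _), ← Real.rpow_mul hn0.le,
    neg_mul, one_div_mul_cancel hp.ne', Real.rpow_neg_one, inv_mul_eq_div]

theorem scaledSignMatrix_mulVec (p : ℝ) (A : Matrix (Fin n) (Fin n) ℤˣ) (x : Fin n → ℝ) :
    scaledSignMatrix p A *ᵥ x =
      (n : ℝ) ^ (-(1 / p)) • fun i => ∑ j, x j * ((A i j : ℤ) : ℝ) := by
  rw [scaledSignMatrix, Matrix.smul_mulVec]
  congr 1
  ext i
  simp [Matrix.mulVec, dotProduct, mul_comm]

theorem ellNorm_scaledSignMatrix_col (hn : n ≠ 0) {p : ℝ} (hp : 0 < p)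
    (A : Matrix (Fin n) (Fin n) ℤˣ) (j : Fin n) :
    ellNorm p (fun i => scaledSignMatrix p A i j) = 1 := by
  have hn0 : (n : ℝ) ≠ 0 := by exact_mod_cast hn
  have h := ellNorm_smul_rpow hn hp fun i => ((A i j : ℤ) : ℝ)
  simp only [abs_sign, Real.one_rpow, sum_const, card_univ, Fintype.card_fin, nsmul_eq_mul,
    mul_one, div_self hn0] at h
  exact (Real.rpow_left_inj (ellNorm_nonneg hp _) zero_le_one hp.ne').1
    (h.trans (Real.one_rpow p).symm)

theorem ellNorm_uniform_le (hn : n ≠ 0) {p : ℝ} (hp : 2 ≤ p) {t : ℝ} (ht : 0 ≤ t)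
    (A : Matrix (Fin n) (Fin n) ℤˣ)
    (h : ∑ i, (∑ j, ((A i j : ℤ) : ℝ) / n) ^ 2 ≤ t ^ p * n) :
    ellNorm p (scaledSignMatrix p A *ᵥ uniformWeights n) ≤ t := by
  have hp0 : 0 < p := by linarith
  have hn0 : (0 : ℝ) < n := by exact_mod_cast Nat.pos_of_ne_zero hn
  refine (Real.rpow_le_rpow_iff (ellNorm_nonneg hp0 _) ht hp0).1 ?_
  rw [scaledSignMatrix_mulVec, ellNorm_smul_rpow hn hp0, div_le_iff₀ hn0]
  refine le_trans (sum_le_sum fun i _ => ?_) h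
  have h1 : ∑ j, uniformWeights n j * ((A i j : ℤ) : ℝ) = ∑ j, ((A i j : ℤ) : ℝ) / n :=
    sum_congr rfl fun j _ => by rw [uniformWeights, one_div_mul_eq_div]
  rw [h1, ← sq_abs, ← Real.rpow_natCast]
  -- Row means lie in `[-1, 1]`, so their `p`-th powers are at most their squares.
  refine Real.rpow_le_rpow_of_exponent_ge_of_imp (abs_nonneg _) ?_ (by exact_mod_cast hp) ?_
  · refine (abs_sum_le_sum_abs _ _).trans ?_
    simp [abs_div, abs_sign, hn0.ne']
  · exact fun _ h0 => absurd h0 hp0.ne'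

/-- Sign matrices rich in patterns inherit the moment bound of Rademacher sums. -/
theorem PatternRich.le_ellNorm {δ κ L p t : ℝ} {A : Matrix (Fin n) (Fin n) ℤˣ} (hp : 2 ≤ p)
    (hκ : 0 ≤ κ) (hA : PatternRich δ ⌊κ⌋₊ A) (hn : n ≠ 0) (hkn : ⌊κ⌋₊ ≤ n) (hδ : δ ≤ 1)
    (ht : 0 ≤ t) (htL : t ^ p ≤ (1 - δ) * L ^ p)
    (hL : ∀ (ι : Type) [Fintype ι] [DecidableEq ι], (Fintype.card ι : ℝ) ≤ κ →
      ∀ x : ι → ℝ, (∀ j, 0 ≤ x j) → ∑ j, x j = 1 → L ^ p ≤ 𝔼 σ, |signSum x univ σ| ^ p)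
    {x : Fin n → ℝ} (hx : x ∈ stdSimplex ℝ (Fin n)) (hxκ : (sparsity x : ℝ) ≤ κ) :
    t ≤ ellNorm p (scaledSignMatrix p A *ᵥ x) := by
  classical
  have hp0 : 0 < p := by linarith
  have hn0 : (0 : ℝ) < n := by exact_mod_cast Nat.pos_of_ne_zero hn
  have hs : #{j | x j ≠ 0} ≤ ⌊κ⌋₊ := by
    refine Nat.le_floor (le_trans (le_of_eq ?_) hxκ)
    rw [sparsity, ← Set.ncard_coe_finset]
    congr 2
    ext j; simp
  -- `PatternRich` concerns sets of exactly `⌊κ⌋₊` columns, so the support is padded.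
  obtain ⟨T, hsT, hT⟩ := exists_superset_card_eq hs (by simpa using hkn)
  have hout : ∀ j ∉ T, x j = 0 := fun j hj => by
    by_contra h
    exact hj (hsT (by simpa using h))
  have hsum : ∀ g : Fin n → ℝ, ∑ j : T, x j * g j = ∑ j, x j * g j := by
    intro g
    rw [sum_coe_sort T (fun j => x j * g j)]
    exact sum_subset (subset_univ _) fun j _ hj => by rw [hout j hj, zero_mul]
  have hmom := hL T (by
    rw [Fintype.card_coe, hT]; exact Nat.floor_le hκ) (fun j => x j) (fun j => hx.1 j)
    (by simpa [hx.2] using hsum fun _ => 1)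
  have hrich := hA.le_sum hT (fun σ => |signSum (fun j : T => x j) univ σ| ^ p)
    fun _ => by positivity
  refine (Real.rpow_le_rpow_iff ht (ellNorm_nonneg hp0 _) hp0).1 ?_
  rw [scaledSignMatrix_mulVec, ellNorm_smul_rpow hn hp0, le_div_iff₀ hn0]
  have h1 : ∀ i, signSum (fun j : T => x j) univ (fun j : T => A i j) =
      ∑ j, x j * ((A i j : ℤ) : ℝ) := fun i => hsum fun j => ((A i j : ℤ) : ℝ)
  simp only [h1] at hrich
  refine le_trans ?_ hrich
  calc t ^ p * n ≤ (1 - δ) * L ^ p * n := by gcongr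
    _ = (1 - δ) * n * L ^ p := by ring
    _ ≤ _ := mul_le_mul_of_nonneg_left hmom (mul_nonneg (by linarith) hn0.le)

theorem tendsto_signMatrixProb_isHardInstance {κ L p ε : ℝ} (hp : 2 ≤ p) (hε : 0 < ε)
    (hκ : 0 ≤ κ) (hεL : 2 * ε < L)
    (hL : ∀ (ι : Type) [Fintype ι] [DecidableEq ι], (Fintype.card ι : ℝ) ≤ κ →
      ∀ x : ι → ℝ, (∀ j, 0 ≤ x j) → ∑ j, x j = 1 → L ^ p ≤ 𝔼 σ, |signSum x univ σ| ^ p) :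
    Tendsto (fun n : ℕ => signMatrixProb n fun A => IsHardInstance p ε κ (scaledSignMatrix p A))
      atTop (𝓝 1) := by
  have hp0 : 0 < p := by linarith
  -- `t` will bound the norm of the uniform combination, so sparse points must reach `2ε + t` for
  -- (d); `δ` below makes `(1 - δ) L^p` equal to `(2ε + t)^p`.
  obtain ⟨t, ht0, htε, htL⟩ : ∃ t : ℝ, 0 < t ∧ t ≤ ε ∧ 2 * ε + t < L :=
    ⟨min ε ((L - 2 * ε) / 2), lt_min hε (by linarith), min_le_left _ _,
      by linarith [min_le_right ε ((L - 2 * ε) / 2)]⟩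
  have hL0 : 0 < L := by linarith
  have hLp : 0 < L ^ p := by positivity
  set δ := 1 - (2 * ε + t) ^ p / L ^ p with hδdef
  have hδ0 : 0 < δ := by
    rw [hδdef, sub_pos, div_lt_one hLp]
    exact Real.rpow_lt_rpow (by positivity) htL hp0
  have hδ1 : δ ≤ 1 := by
    have : 0 ≤ (2 * ε + t) ^ p / L ^ p := by positivity
    linarith
  have hδL : (2 * ε + t) ^ p ≤ (1 - δ) * L ^ p := by
    rw [hδdef, sub_sub_cancel, div_mul_cancel₀ _ hLp.ne']
  set k := ⌊κ⌋₊ with hk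
  set ρ := Real.exp (-(1 / 2 ^ k * (1 - Real.exp (-δ) - δ + δ ^ 2))) with hρ
  have hρ1 : ρ < 1 := by
    rw [hρ, Real.exp_lt_one_iff, neg_lt_zero]
    exact mul_pos (by positivity) (chernoff_exponent_pos hδ0)
  have hlim : Tendsto (fun n : ℕ => 1 - (n : ℝ) ^ k * 2 ^ k * ρ ^ n - 1 / (t ^ p * n))
      atTop (𝓝 1) := by
    have h1 : Tendsto (fun n : ℕ => (n : ℝ) ^ k * ρ ^ n) atTop (𝓝 0) :=
      tendsto_pow_const_mul_const_pow_of_abs_lt_one k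
        (by rwa [abs_of_pos (Real.exp_pos _)])
    have h2 : Tendsto (fun n : ℕ => 1 / (t ^ p * (n : ℝ))) atTop (𝓝 0) :=
      tendsto_const_nhds.div_atTop
        (tendsto_natCast_atTop_atTop.const_mul_atTop (by positivity))
    have h3 := (tendsto_const_nhds (x := (1 : ℝ))).sub (h1.const_mul (2 ^ k)) |>.sub h2
    simp only [mul_zero, sub_zero] at h3
    refine h3.congr fun n => ?_
    ring
  refine tendsto_of_tendsto_of_tendsto_of_le_of_le' hlim tendsto_const_nhds ?_
    (Eventually.of_forall fun n => signMatrixProb_le_one _)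
  filter_upwards [eventually_ge_atTop (max 1 k)] with n hn
  have hn0 : n ≠ 0 := by have := (le_max_left 1 k).trans hn; omega
  refine le_signMatrixProb_of_patternRich hn0 hδ0.le (by positivity) k _ fun A hR hU => ?_
  have hu := ellNorm_uniform_le hn0 hp ht0.le A hU
  have hfar : ∀ x ∈ stdSimplex ℝ (Fin n), (sparsity x : ℝ) ≤ κ →
      2 * ε + t ≤ ellNorm p (scaledSignMatrix p A *ᵥ x) := fun x hx hxκ =>
    hR.le_ellNorm hp hκ hn0 ((le_max_right 1 k).trans hn) hδ1 (by positivity) hδL hL hx hxκ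
  refine ⟨ellNorm_scaledSignMatrix_col hn0 hp0 A, hu.trans htε, fun x hx hxκ => ?_,
    fun x hx hxκ => ?_⟩
  · linarith [hfar x hx hxκ]
  · linarith [hfar x hx hxκ, ellNorm_sub_ge (by linarith : 1 ≤ p) (scaledSignMatrix p A *ᵥ x)
      (scaledSignMatrix p A *ᵥ uniformWeights n)]

theorem uniformWeights_mem_stdSimplex (hn : n ≠ 0) :
    uniformWeights n ∈ stdSimplex ℝ (Fin n) := by
  have : (n : ℝ) ≠ 0 := by exact_mod_cast hn
  exact ⟨fun _ => by unfold uniformWeights; positivity, by simp [uniformWeights, this]⟩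

theorem IsHardInstance.lt_of_isSparsityBound {p ε k : ℝ} {V : Matrix (Fin n) (Fin n) ℝ}
    (hV : IsHardInstance p ε k V) (hn : n ≠ 0) (hε : 0 < ε) {N : ℕ}
    (hN : IsSparsityBound p ε N) : k < N := by
  by_contra! h
  obtain ⟨x, hx, hxN, hxε⟩ := hN n n V (fun j => (hV.norm_col j).le) _
    (uniformWeights_mem_stdSimplex hn)
  have := hV.sparse_far_uniform x hx (le_trans (by exact_mod_cast hxN) h)
  linarith

theorem exists_of_signMatrixProb_pos {P : Matrix (Fin n) (Fin n) ℤˣ → Prop}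
    (h : 0 < signMatrixProb n P) : ∃ A, P A := by
  by_contra! h'
  simp [signMatrixProb, h'] at h

end HardInstance

end ApproxCaratheodory

theorem mainTheorem2 (ε₀ : ℝ) (hε₀ : ε₀ < 1 / 2) :
    ∃ K : ℝ, 0 < K ∧ ∀ p : ℝ, 2 ≤ p → ∀ ε : ℝ, 0 < ε → ε ≤ ε₀ →
      (∃ n₀ : ℕ, ∀ n : ℕ, n₀ ≤ n → ∃ A : Matrix (Fin n) (Fin n) ℤˣ,
        ApproxCaratheodory.IsHardInstance p ε (K * p / ε ^ 2)
          (ApproxCaratheodory.scaledSignMatrix p A)) ∧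
      Tendsto (fun n : ℕ => ApproxCaratheodory.signMatrixProb n (fun A =>
        ApproxCaratheodory.IsHardInstance p ε (K * p / ε ^ 2)
          (ApproxCaratheodory.scaledSignMatrix p A))) atTop (𝓝 1) ∧
      (∀ N : ℕ, ApproxCaratheodory.IsSparsityBound p ε N → K * p / ε ^ 2 < (N : ℝ)) := by
  obtain ⟨K, hK, hmom⟩ := ApproxCaratheodory.exists_moment_bound hε₀
  refine ⟨K, hK, fun p hp ε hε hεε₀ => ?_⟩
  obtain ⟨L, hεL, hL⟩ := hmom p hp ε hε hεε₀
  have hlim := ApproxCaratheodory.tendsto_signMatrixProb_isHardInstance hp hε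
    (by positivity : 0 ≤ K * p / ε ^ 2) hεL hL
  obtain ⟨n₀, hn₀⟩ : ∃ n₀ : ℕ, ∀ n : ℕ, n₀ ≤ n → ∃ A : Matrix (Fin n) (Fin n) ℤˣ,
      ApproxCaratheodory.IsHardInstance p ε (K * p / ε ^ 2)
        (ApproxCaratheodory.scaledSignMatrix p A) := by
    obtain ⟨n₀, h⟩ := eventually_atTop.1 (hlim.eventually (lt_mem_nhds zero_lt_one))
    exact ⟨n₀, fun n hn => ApproxCaratheodory.exists_of_signMatrixProb_pos (h n hn)⟩
  refine ⟨⟨n₀, hn₀⟩, hlim, fun N hN => ?_⟩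
  obtain ⟨A, hA⟩ := hn₀ (n₀ + 1) (Nat.le_succ _)
  exact hA.lt_of_isSparsityBound (Nat.succ_ne_zero _) hε hN
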